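/- Rings are associative and need not have a unit. Let $R$ be a ring. Two idempotents $p,q\in R$ are equivalent, $p\sim q$, if there are $x,y\in R$ with $xy=p$ and $yx=q$; an idempotent $e\in R$ is infinite if $e=f+g$ for idempotents $f,g\in R$ with $fg=gf=0$, $e\sim f$ and $g\neq 0$. The ring $R$ is purely infinite simple if it is simple (that is, $R\neq 0$ and its only two-sided ideals are $0$ and $R$) and every nonzero right ideal of $R$ contains an infinite idempotent. The ring $R$ is $\sigma$-unital if there is a net $(u_\lambda)_{\lambda\in\Lambda}$ in $R$, indexed by a nonempty countable directed set $\Lambda$, such that for every $a\in R$ there is $\lambda_0\in\Lambda$ with $u_\lambda a=a=au_\lambda$ for all $\lambda\ge\lambda_0$. The ring $R$ is stable if $R\cong M_\infty(S)$ for some ring $S$, where $M_\infty(S)$ is the ring of $\mathbb N\times\mathbb N$ matrices over $S$ with only finitely many nonzero entries. **Corollary 2.6 (algebraic Zhang dichotomy).** Every $\sigma$-unital purely infinite simple ring is either unital or stable, and not both. -/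

import Mathlib

/-! Rings are associative and not assumed to have a unit: `NonUnitalRing`. -/

/-- The ring `R` has a two-sided unit element. -/
def IsUnitalRing (R : Type*) [NonUnitalRing R] : Prop :=
  ∃ e : R, ∀ a : R, e * a = a ∧ a * e = a

/-- Equivalence `p ∼ q` of idempotents: `p = x * y` and `q = y * x` for some ring elements. -/
def IdempotentEquiv {R : Type*} [NonUnitalRing R] (p q : R) : Prop :=
  ∃ x y : R, x * y = p ∧ y * x = q

/-- The idempotent `e` is infinite: `e = f + g` for orthogonal idempotents `f`, `g`
with `e ∼ f` and `g ≠ 0`. -/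
def IsInfiniteIdempotent {R : Type*} [NonUnitalRing R] (e : R) : Prop :=
  IsIdempotentElem e ∧
    ∃ f g : R, IsIdempotentElem f ∧ IsIdempotentElem g ∧ f * g = 0 ∧ g * f = 0 ∧
      e = f + g ∧ IdempotentEquiv e f ∧ g ≠ 0

/-- An additive subgroup of `R` is a right ideal if it is stable under right multiplication
by elements of `R`. -/
def IsRightIdeal {R : Type*} [NonUnitalRing R] (I : AddSubgroup R) : Prop :=
  ∀ x ∈ I, ∀ r : R, x * r ∈ I

/-- `R` is purely infinite simple: it is simple (`R ≠ 0` and the only two-sided ideals are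
`0` and `R`) and every nonzero right ideal contains an infinite idempotent. An infinite idempotent
is nonzero, so that `R * R ≠ 0` is automatic. -/
def IsPurelyInfiniteSimple (R : Type*) [NonUnitalRing R] : Prop :=
  IsSimpleRing R ∧
    ∀ I : AddSubgroup R, IsRightIdeal I → I ≠ ⊥ → ∃ e ∈ I, IsInfiniteIdempotent e

/-- The net `u` in `R` is an approximate unit: it converges to `1` in the strict topology,
that is, `(u l - 1) * a = 0 = a * (u l - 1)` for all large `l`, for every `a`. -/
def IsApproximateUnit {R Λ : Type*} [NonUnitalRing R] [Preorder Λ] (u : Λ → R) : Prop :=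
  ∀ a : R, ∃ l₀ : Λ, ∀ l : Λ, l₀ ≤ l → u l * a = a ∧ a * u l = a

/-- `R` is σ-unital: it has an approximate unit indexed by a (nonempty) countable directed set. -/
def IsSigmaUnital (R : Type*) [NonUnitalRing R] : Prop :=
  ∃ (Λ : Type) (_ : Preorder Λ) (_ : IsDirectedOrder Λ) (_ : Nonempty Λ) (_ : Countable Λ)
    (u : Λ → R), IsApproximateUnit u

/-- The `ℕ × ℕ` matrices over `S` that vanish outside some upper left `n × n` corner, that is,
with only finitely many nonzero entries. -/
def finitaryMatrices (S : Type*) [NonUnitalRing S] : AddSubgroup (Matrix ℕ ℕ S) where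
  carrier := {A | ∃ n : ℕ, ∀ i j : ℕ, n ≤ i ∨ n ≤ j → A i j = 0}
  zero_mem' := ⟨0, fun _ _ _ => rfl⟩
  add_mem' := by
    rintro A B ⟨m, hm⟩ ⟨n, hn⟩
    refine ⟨max m n, fun i j h => ?_⟩
    rw [Matrix.add_apply, hm i j (by omega), hn i j (by omega), add_zero]
  neg_mem' := by
    rintro A ⟨m, hm⟩
    exact ⟨m, fun i j h => by rw [Matrix.neg_apply, hm i j h, neg_zero]⟩

/-- The ring `M_∞(S)`. -/
def MInfty (S : Type*) [NonUnitalRing S] : Type _ := finitaryMatrices S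

namespace MInfty

variable {S : Type*} [NonUnitalRing S]

instance : AddCommGroup (MInfty S) := inferInstanceAs (AddCommGroup (finitaryMatrices S))

/-- The entry of a matrix at row `i` and column `j`. -/
def entry (A : MInfty S) (i j : ℕ) : S := A.1 i j

@[ext] theorem ext {A B : MInfty S} (h : ∀ i j, A.entry i j = B.entry i j) : A = B :=
  Subtype.ext (Matrix.ext h)

theorem exists_bound (A : MInfty S) :
    ∃ n : ℕ, ∀ i j : ℕ, n ≤ i ∨ n ≤ j → A.entry i j = 0 := A.2

theorem sum_eq_range (A : MInfty S) {n : ℕ} (h : ∀ i j : ℕ, n ≤ i ∨ n ≤ j → A.entry i j = 0)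
    (B : MInfty S) (i k : ℕ) :
    ∑ᶠ j, A.entry i j * B.entry j k = ∑ j ∈ Finset.range n, A.entry i j * B.entry j k := by
  refine finsum_eq_sum_of_support_subset _ fun j hj => ?_
  by_contra hjn
  exact hj (by simp [h i j (Or.inr (by simpa using hjn))])

/-- Matrix multiplication; each of the sums has only finitely many nonzero terms. -/
noncomputable instance : Mul (MInfty S) where
  mul A B := ⟨Matrix.of fun i k => ∑ᶠ j, A.entry i j * B.entry j k, by
    obtain ⟨m, hm⟩ := A.exists_bound
    obtain ⟨n, hn⟩ := B.exists_bound
    refine ⟨max m n, fun i k h => ?_⟩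
    rw [Matrix.of_apply, ← finsum_zero (α := ℕ)]
    refine finsum_congr fun j => ?_
    rcases h with h | h
    · rw [hm i j (Or.inl (by omega)), zero_mul]
    · rw [hn j k (Or.inr (by omega)), mul_zero]⟩

@[simp] theorem entry_zero (i j : ℕ) : (0 : MInfty S).entry i j = 0 := rfl

@[simp] theorem entry_add (A B : MInfty S) (i j : ℕ) :
    (A + B).entry i j = A.entry i j + B.entry i j := rfl

theorem entry_mul (A B : MInfty S) (i k : ℕ) :
    (A * B).entry i k = ∑ᶠ j, A.entry i j * B.entry j k := rfl

theorem entry_mul_range (A B : MInfty S) {n : ℕ}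
    (h : ∀ i j : ℕ, n ≤ i ∨ n ≤ j → A.entry i j = 0) (i k : ℕ) :
    (A * B).entry i k = ∑ j ∈ Finset.range n, A.entry i j * B.entry j k :=
  sum_eq_range A h B i k

theorem exists_bound_two (A B : MInfty S) : ∃ n : ℕ,
    (∀ i j : ℕ, n ≤ i ∨ n ≤ j → A.entry i j = 0) ∧
      ∀ i j : ℕ, n ≤ i ∨ n ≤ j → B.entry i j = 0 := by
  obtain ⟨m, hm⟩ := A.exists_bound
  obtain ⟨n, hn⟩ := B.exists_bound
  exact ⟨max m n, fun i j h => hm i j (by omega), fun i j h => hn i j (by omega)⟩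

noncomputable instance : NonUnitalRing (MInfty S) where
  left_distrib A B C := by
    obtain ⟨n, hn⟩ := A.exists_bound
    ext i k
    simp only [entry_add, entry_mul_range A _ hn, mul_add, Finset.sum_add_distrib]
  right_distrib A B C := by
    obtain ⟨n, hA, hB⟩ := exists_bound_two A B
    have hAB : ∀ i j : ℕ, n ≤ i ∨ n ≤ j → (A + B).entry i j = 0 := fun i j h => by
      rw [entry_add, hA i j h, hB i j h, add_zero]
    ext i k
    simp only [entry_add, entry_mul_range _ _ hA, entry_mul_range _ _ hB,
      entry_mul_range _ _ hAB, add_mul, Finset.sum_add_distrib]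
  zero_mul A := by
    ext i k
    simp [entry_mul]
  mul_zero A := by
    ext i k
    simp [entry_mul]
  mul_assoc A B C := by
    obtain ⟨n, hA, hB⟩ := exists_bound_two A B
    have hAB : ∀ i j : ℕ, n ≤ i ∨ n ≤ j → (A * B).entry i j = 0 := fun i j h => by
      rw [entry_mul_range A B hA]
      refine Finset.sum_eq_zero fun l _ => ?_
      rcases h with h | h
      · rw [hA i l (Or.inl h), zero_mul]
      · rw [hB l j (Or.inr h), mul_zero]
    ext i k
    simp only [entry_mul_range _ _ hA, entry_mul_range _ _ hB, entry_mul_range _ _ hAB,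
      Finset.sum_mul, Finset.mul_sum, mul_assoc]
    exact Finset.sum_comm

end MInfty

/-- `R` is stable: it is isomorphic to `M_∞(S)` for some (not necessarily unital) ring `S`. -/
def IsStableRing.{u} (R : Type u) [NonUnitalRing R] : Prop :=
  ∃ (S : Type u) (_ : NonUnitalRing S), Nonempty (R ≃+* MInfty S)

/-! In a simple ring every element factors through any infinite idempotent
(`IsInfiniteIdempotent.isFullIdempotent`). If there is no unit, such full idempotents exist
orthogonally to any given element. That room lets any idempotent be enlarged so as to absorb a given
element, with an increment equivalent to one fixed full `f` (`exists_isIdempotentElem_extension`).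
By σ-unitality, countably many enlargements exhaust the ring, and cutting along the increments
identifies it with `M_∞(fRf)` (`isStableRing_of_seq`). Unital and stable exclude each other because
a would-be unit of `M_∞(S)` has zero rows. -/

/-- An idempotent `p` through which every element of the ring factors. -/
def IsFullIdempotent {R : Type*} [NonUnitalRing R] (p : R) : Prop :=
  IsIdempotentElem p ∧ ∀ b : R, ∃ x y : R, x * p = x ∧ p * y = y ∧ x * y = b

/-! ### Factoring through full idempotents -/

section Ring

variable {R : Type*} [NonUnitalRing R]

theorem mem_closure_mul_mul_of_isSimpleRing [IsSimpleRing R] {g : R} (hg : IsIdempotentElem g)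
    (hg0 : g ≠ 0) (b : R) :
    b ∈ AddSubmonoid.closure {z : R | ∃ x y : R, z = x * g * y} := by
  set M := AddSubmonoid.closure {z : R | ∃ x y : R, z = x * g * y} with hM
  have hl : ∀ {x y : R}, y ∈ M → x * y ∈ M := by
    intro x y hy
    induction hy using AddSubmonoid.closure_induction with
    | mem z hz =>
      obtain ⟨u, v, rfl⟩ := hz
      exact AddSubmonoid.subset_closure ⟨x * u, v, by simp only [mul_assoc]⟩
    | zero => rw [mul_zero]; exact M.zero_mem
    | add u v _ _ hu hv => rw [mul_add]; exact M.add_mem hu hv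
  have hr : ∀ {x y : R}, x ∈ M → x * y ∈ M := by
    intro x y hx
    induction hx using AddSubmonoid.closure_induction with
    | mem z hz =>
      obtain ⟨u, v, rfl⟩ := hz
      exact AddSubmonoid.subset_closure ⟨u, v * y, by simp only [mul_assoc]⟩
    | zero => rw [zero_mul]; exact M.zero_mem
    | add u v _ _ hu hv => rw [add_mul]; exact M.add_mem hu hv
  have hn : ∀ {x : R}, x ∈ M → -x ∈ M := by
    intro x hx
    induction hx using AddSubmonoid.closure_induction with
    | mem z hz =>
      obtain ⟨u, v, rfl⟩ := hz
      exact AddSubmonoid.subset_closure ⟨-u, v, by simp only [neg_mul]⟩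
    | zero => rw [neg_zero]; exact M.zero_mem
    | add u v _ _ hu hv => rw [neg_add]; exact M.add_mem hu hv
  let I : TwoSidedIdeal R := TwoSidedIdeal.mk' (M : Set R) M.zero_mem M.add_mem hn hl hr
  have hgI : g ∈ I := by
    rw [TwoSidedIdeal.mem_mk']
    exact AddSubmonoid.subset_closure ⟨g, g, by rw [hg.eq, hg.eq]⟩
  have hI : I = ⊤ := by
    refine (eq_bot_or_eq_top I).resolve_left fun h => hg0 ?_
    rw [h] at hgI
    exact (TwoSidedIdeal.mem_bot R).1 hgI
  have hb : b ∈ I := by rw [hI]; trivial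
  rwa [TwoSidedIdeal.mem_mk'] at hb

/-- By simplicity `b` is a finite sum of terms `u * g * v`. The equivalence `p ∼ f` yields `t * s =
p` with `s`, `t` orthogonal to `g`, so a new term fits beside an existing factorization: `u g v + x₁
y₁ = (u g + x₁ t)(g v + s y₁)`. -/
theorem IsInfiniteIdempotent.isFullIdempotent [IsSimpleRing R] {p : R}
    (hp : IsInfiniteIdempotent p) : IsFullIdempotent p := by
  obtain ⟨hpp, f, g, hf, hg, hfg, hgf, rfl, ⟨x, y, hxy, hyx⟩, hg0⟩ := hp
  refine ⟨hpp, fun b => ?_⟩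
  have hf' := hf.eq
  have hg' := hg.eq
  set p := f + g with hpdef
  have hpf : p * f = f := by rw [hpdef, add_mul, hf', hgf, add_zero]
  have hpg : p * g = g := by rw [hpdef, add_mul, hg', hfg, zero_add]
  have hgp : g * p = g := by rw [hpdef, mul_add, hg', hgf, zero_add]
  obtain ⟨s, t, hts, hps, htp, hgs, htg⟩ : ∃ s t : R,
      t * s = p ∧ p * s = s ∧ t * p = t ∧ g * s = 0 ∧ t * g = 0 := by
    refine ⟨f * y, x * f, ?_, ?_, ?_, ?_, ?_⟩
    · calc x * f * (f * y) = x * (f * f) * y := by simp only [mul_assoc]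
        _ = (x * y) * (x * y) := by rw [hf', ← hyx]; simp only [mul_assoc]
        _ = p := by rw [hxy, hpp.eq]
    · rw [← mul_assoc, hpf]
    · rw [mul_assoc, hpdef, mul_add, hf', hfg, add_zero]
    · rw [← mul_assoc, hgf, zero_mul]
    · rw [mul_assoc, hfg, mul_zero]
  have hb := mem_closure_mul_mul_of_isSimpleRing hg hg0 b
  induction hb using AddSubmonoid.closure_induction_left with
  | zero => exact ⟨0, 0, by simp, by simp, by simp⟩
  | add_left z hz w _ hw =>
    obtain ⟨u, v, rfl⟩ := hz
    obtain ⟨x₁, y₁, hx₁, hy₁, rfl⟩ := hw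
    refine ⟨u * g + x₁ * t, g * v + s * y₁, ?_, ?_, ?_⟩
    · rw [add_mul, mul_assoc, mul_assoc, hgp, htp]
    · rw [mul_add, ← mul_assoc, ← mul_assoc, hpg, hps]
    · have h1 : u * g * (g * v) = u * g * v := by rw [mul_assoc, ← mul_assoc g, hg', mul_assoc]
      have h2 : u * g * (s * y₁) = 0 := by
        rw [mul_assoc, ← mul_assoc g, hgs, zero_mul, mul_zero]
      have h3 : x₁ * t * (g * v) = 0 := by
        rw [mul_assoc, ← mul_assoc t, htg, zero_mul, mul_zero]
      have h4 : x₁ * t * (s * y₁) = x₁ * y₁ := by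
        rw [mul_assoc, ← mul_assoc t, hts, hy₁]
      rw [mul_add, add_mul, add_mul, h1, h2, h3, h4, add_zero, zero_add]

theorem IsFullIdempotent.exists_factorization {p : R} (hp : IsFullIdempotent p) {h : R}
    (hh : IsIdempotentElem h) :
    ∃ x y : R, x * y = h ∧ h * x = x ∧ x * p = x ∧ p * y = y ∧ y * h = y := by
  obtain ⟨x, y, hx, hy, hxy⟩ := hp.2 h
  refine ⟨h * x, y * h, ?_, ?_, ?_, ?_, ?_⟩
  · rw [mul_assoc, ← mul_assoc x, hxy, hh.eq, hh.eq]
  · rw [← mul_assoc, hh.eq]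
  · rw [mul_assoc, hx]
  · rw [← mul_assoc, hy]
  · rw [mul_assoc, hh.eq]

/-! ### Local units and absorbing idempotents -/

theorem IsSigmaUnital.exists_seq (hσ : IsSigmaUnital R) :
    ∃ u : ℕ → R, ∀ a b : R, ∃ n, u n * a = a ∧ a * u n = a ∧ u n * b = b ∧ b * u n = b := by
  obtain ⟨Λ, _, _, _, _, u, hu⟩ := hσ
  obtain ⟨φ, hφ⟩ := exists_surjective_nat Λ
  refine ⟨u ∘ φ, fun a b => ?_⟩
  obtain ⟨k, hk⟩ := hu a
  obtain ⟨l, hl⟩ := hu b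
  obtain ⟨m, hkm, hlm⟩ := exists_ge_ge k l
  obtain ⟨n, rfl⟩ := hφ m
  exact ⟨n, (hk _ hkm).1, (hk _ hkm).2, (hl _ hlm).1, (hl _ hlm).2⟩

/-- The right annihilator of a local unit `b` of `a` is nonzero, since otherwise a local unit of `b`
would be a unit of `R`. An infinite idempotent `p` in it has `b * p = 0`, and `p(1 - b)` is still
full but now kills `a` on both sides. -/
theorem exists_orthogonal_isFullIdempotent
    (hloc : ∀ a b : R, ∃ u : R, u * a = a ∧ a * u = a ∧ u * b = b ∧ b * u = b)
    (hR : IsPurelyInfiniteSimple R) (hu : ¬ IsUnitalRing R) (a : R) :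
    ∃ p : R, IsFullIdempotent p ∧ p * a = 0 ∧ a * p = 0 := by
  obtain ⟨hs, hR⟩ := hR
  obtain ⟨b, hba, hab, -, -⟩ := hloc a a
  obtain ⟨c, hcb, hbc, -, -⟩ := hloc b b
  have hI : (AddMonoidHom.mulLeft b).ker ≠ ⊥ := by
    intro h
    have hc : ∀ y, c * y = y := by
      intro y
      have : c * y - y ∈ (AddMonoidHom.mulLeft b).ker := by
        rw [AddMonoidHom.mem_ker, AddMonoidHom.coe_mulLeft, mul_sub, ← mul_assoc, hbc, sub_self]
      rw [h, AddSubgroup.mem_bot] at this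
      exact sub_eq_zero.1 this
    refine hu ⟨c, fun y => ⟨hc y, ?_⟩⟩
    -- As `c` is a left unit, a local unit `d` of `c` and `y` must equal `c`.
    obtain ⟨d, -, hcd, -, hyd⟩ := hloc c y
    rwa [← hcd, hc d]
  obtain ⟨p, hpI, hp⟩ := hR _ (fun x hx r => by
    rw [AddMonoidHom.mem_ker, AddMonoidHom.coe_mulLeft] at hx ⊢
    rw [← mul_assoc, hx, zero_mul]) hI
  rw [AddMonoidHom.mem_ker, AddMonoidHom.coe_mulLeft] at hpI
  obtain ⟨hpp, hfull⟩ := hp.isFullIdempotent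
  have hqp : (p - p * b) * p = p := by rw [sub_mul, hpp.eq, mul_assoc, hpI, mul_zero, sub_zero]
  have hpq : p * (p - p * b) = p - p * b := by rw [mul_sub, ← mul_assoc, hpp.eq]
  have hqq : (p - p * b) * (p - p * b) = p - p * b := by
    rw [mul_sub, ← mul_assoc, hqp]
  refine ⟨p - p * b, ⟨hqq, fun z => ?_⟩, ?_, ?_⟩
  · obtain ⟨x, y, hx, hy, hxy⟩ := hfull z
    have hqy : (p - p * b) * y = y := by rw [← hy, ← mul_assoc, hqp]
    exact ⟨x * (p - p * b), y, by rw [mul_assoc, hqq], hqy, by rw [mul_assoc, hqy, hxy]⟩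
  · rw [sub_mul, mul_assoc, hba, sub_self]
  · rw [mul_sub, ← mul_assoc, ← hab, mul_assoc a b p, hpI, mul_zero, zero_mul, sub_zero]

/-- Factor a local unit `b = x * y` of `a` through a full `p` orthogonal to it. The column `A = (p -
yx) + x` has the left inverse `B = (p - yx) + y(2 - b)`, so `A * B` is idempotent. It fixes `a`
because `b` acts on `a` as `1`. -/
theorem exists_isIdempotentElem_absorbing
    (hloc : ∀ a b : R, ∃ u : R, u * a = a ∧ a * u = a ∧ u * b = b ∧ b * u = b)
    (horth : ∀ a : R, ∃ p : R, IsFullIdempotent p ∧ p * a = 0 ∧ a * p = 0) (a : R) :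
    ∃ e : R, IsIdempotentElem e ∧ e * a = a ∧ a * e = a := by
  obtain ⟨b, hba, hab, -, -⟩ := hloc a a
  obtain ⟨c, hcb, hbc, -, -⟩ := hloc b b
  obtain ⟨p, ⟨hpp, hp⟩, hpc, hcp⟩ := horth c
  have hpp' := hpp.eq
  have hpa : p * a = 0 := by
    rw [← hba, ← hcb, ← mul_assoc, ← mul_assoc, hpc, zero_mul, zero_mul]
  have hap : a * p = 0 := by
    rw [← hab, ← hbc, mul_assoc, mul_assoc, hcp, mul_zero, mul_zero]
  obtain ⟨x, y, hxp, hpy, hpx, hyp, hxy⟩ : ∃ x y : R,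
      x * p = x ∧ p * y = y ∧ p * x = 0 ∧ y * p = 0 ∧ x * y = b := by
    obtain ⟨x, y, hx, hy, hxy⟩ := hp b
    refine ⟨c * x, y * c, ?_, ?_, ?_, ?_, ?_⟩
    · rw [mul_assoc, hx]
    · rw [← mul_assoc, hy]
    · rw [← mul_assoc, hpc, zero_mul]
    · rw [mul_assoc, hcp, mul_zero]
    · rw [mul_assoc, ← mul_assoc x, hxy, hbc, hcb]
  have hxx : x * x = 0 := by rw [← hxp, mul_assoc, ← mul_assoc p, hpx, zero_mul, mul_zero]
  have hyy : y * y = 0 := by rw [← hpy, mul_assoc, ← mul_assoc y, hyp, zero_mul, mul_zero]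
  have hxa : x * a = 0 := by rw [← hxp, mul_assoc, hpa, mul_zero]
  have hay : a * y = 0 := by rw [← hpy, ← mul_assoc, hap, zero_mul]
  have hxyl : ∀ z, x * (y * z) = b * z := fun z => by rw [← mul_assoc, hxy]
  have hpyl : ∀ z, p * (y * z) = y * z := fun z => by rw [← mul_assoc, hpy]
  have hyyl : ∀ z, y * (y * z) = 0 := fun z => by rw [← mul_assoc, hyy, zero_mul]
  have hayl : ∀ z, a * (y * z) = 0 := fun z => by rw [← mul_assoc, hay, zero_mul]
  have habl : ∀ z, a * (b * z) = a * z := fun z => by rw [← mul_assoc, hab]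
  have hbp : b * p = 0 := by rw [← hxy, mul_assoc, hyp, mul_zero]
  have hby : b * y = 0 := by rw [← hxy, mul_assoc, hyy, mul_zero]
  have hbyl : ∀ z, b * (y * z) = 0 := fun z => by rw [← mul_assoc, hby, zero_mul]
  -- `(p - yx)² + y(2 - b)x = p`, as `y * b * x = (yx)²`.
  have hBA : (p + y + y - y * x - y * b) * (p + x - y * x) = p := by
    simp only [mul_add, add_mul, mul_sub, sub_mul, mul_assoc, hpp', hpx, hxp, hyp, hxx, hxyl,
      hpyl, hyyl, hbp, hbyl, mul_zero]
    abel
  have hAp : (p + x - y * x) * p = p + x - y * x := by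
    simp only [add_mul, sub_mul, mul_assoc, hpp', hxp]
  have hBa : (p + y + y - y * x - y * b) * a = y * a := by
    simp only [add_mul, sub_mul, mul_assoc, hpa, hxa, hba, mul_zero]
    abel
  have haA : a * (p + x - y * x) = a * x := by
    rw [mul_sub, mul_add, hap, hayl, zero_add, sub_zero]
  refine ⟨(p + x - y * x) * (p + y + y - y * x - y * b), ?_, ?_, ?_⟩
  · rw [IsIdempotentElem, mul_assoc, ← mul_assoc _ (p + x - y * x), hBA, ← mul_assoc, hAp]
  · rw [mul_assoc, hBa]
    simp only [add_mul, sub_mul, mul_assoc, hpyl, hxyl, hba]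
    abel
  · rw [← mul_assoc, haA]
    simp only [mul_add, mul_sub, mul_assoc, hxp, hxy, hxyl, hab, habl]
    abel

/-- Take an idempotent `d` absorbing `e` and `a`. Then `d - e` is equivalent to a subidempotent `y *
x` of `f`; the rest `f - y * x` is equivalent to some `w * z` orthogonal to `d`. Adding `w * z` to
`d` completes the increment to a copy of `f`. -/
theorem exists_isIdempotentElem_extension
    (hloc : ∀ a b : R, ∃ u : R, u * a = a ∧ a * u = a ∧ u * b = b ∧ b * u = b)
    (horth : ∀ a : R, ∃ p : R, IsFullIdempotent p ∧ p * a = 0 ∧ a * p = 0)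
    {f : R} (hf : IsFullIdempotent f) {e : R} (he : IsIdempotentElem e) (a : R) :
    ∃ e' : R, IsIdempotentElem e' ∧ e' * e = e ∧ e * e' = e ∧ e' * a = a ∧ a * e' = a ∧
      ∃ x y : R, x * y = f ∧ y * x = e' - e ∧ f * x = x ∧ y * f = y := by
  obtain ⟨b, hbe, heb, hba, hab⟩ := hloc e a
  obtain ⟨d, hd, hdb, hbd⟩ := exists_isIdempotentElem_absorbing hloc horth b
  have hde : d * e = e := by rw [← hbe, ← mul_assoc, hdb]
  have hed : e * d = e := by rw [← heb, mul_assoc, hbd]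
  have hda : d * a = a := by rw [← hba, ← mul_assoc, hdb]
  have had : a * d = a := by rw [← hab, mul_assoc, hbd]
  obtain ⟨p, hp, hpd, hdp⟩ := horth d
  have hh : IsIdempotentElem (d - e) := by
    rw [IsIdempotentElem, mul_sub, sub_mul, sub_mul, hd.eq, hed, hde, he.eq]; abel
  have hdh : d * (d - e) = d - e := by rw [mul_sub, hd.eq, hde]
  have hhd : (d - e) * d = d - e := by rw [sub_mul, hd.eq, hed]
  obtain ⟨x, y, hxy, hhx, hxf, hfy, hyh⟩ := hf.exists_factorization hh
  have hff := hf.1.eq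
  have hxyx : x * (y * x) = x := by rw [← mul_assoc, hxy, hhx]
  have hyxy : y * x * y = y := by rw [mul_assoc, hxy, hyh]
  have hk : IsIdempotentElem (f - y * x) := by
    have h1 : f * (y * x) = y * x := by rw [← mul_assoc, hfy]
    have h2 : y * x * f = y * x := by rw [mul_assoc, hxf]
    have h3 : y * x * (y * x) = y * x := by rw [mul_assoc, hxyx]
    rw [IsIdempotentElem, mul_sub, sub_mul, sub_mul, hff, h1, h2, h3]; abel
  have hfk : f * (f - y * x) = f - y * x := by rw [mul_sub, hff, ← mul_assoc, hfy]
  have hkf : (f - y * x) * f = f - y * x := by rw [sub_mul, hff, mul_assoc, hxf]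
  have hxk : x * (f - y * x) = 0 := by rw [mul_sub, hxf, hxyx, sub_self]
  have hky : (f - y * x) * y = 0 := by rw [sub_mul, hfy, hyxy, sub_self]
  obtain ⟨z, w, hzw, hkz, hzp, hpw, hwk⟩ := hp.exists_factorization hk
  have hzd : z * d = 0 := by rw [← hzp, mul_assoc, hpd, mul_zero]
  have hdw : d * w = 0 := by rw [← hpw, ← mul_assoc, hdp, zero_mul]
  have hyd : y * d = y := by rw [← hyh, mul_assoc, hhd]
  have hdx : d * x = x := by rw [← hhx, ← mul_assoc, hdh]
  have hyw : y * w = 0 := by rw [← hyd, mul_assoc, hdw, mul_zero]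
  have hzx : z * x = 0 := by rw [← hdx, ← mul_assoc, hzd, zero_mul]
  have hxz : x * z = 0 := by rw [← hkz, ← mul_assoc, hxk, zero_mul]
  have hwy : w * y = 0 := by rw [← hwk, mul_assoc, hky, mul_zero]
  have hwzd : ∀ r, d * r = r → w * z * r = 0 := fun r hr => by
    rw [← hr, mul_assoc, ← mul_assoc z, hzd, zero_mul, mul_zero]
  have hdwz : ∀ r, r * d = r → r * (w * z) = 0 := fun r hr => by
    rw [← hr, mul_assoc, ← mul_assoc d, hdw, zero_mul, mul_zero]
  have hwz : w * z * (w * z) = w * z := by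
    rw [mul_assoc, ← mul_assoc z, hzw, hkz]
  refine ⟨d + w * z, ?_, ?_, ?_, ?_, ?_, y + z, x + w, ?_, ?_, ?_, ?_⟩
  · rw [IsIdempotentElem, mul_add, add_mul, add_mul, hd.eq, hwz, hwzd d hd, hdwz d hd, add_zero,
      zero_add]
  · rw [add_mul, hde, hwzd e hde, add_zero]
  · rw [mul_add, hed, hdwz e hed, add_zero]
  · rw [add_mul, hda, hwzd a hda, add_zero]
  · rw [mul_add, had, hdwz a had, add_zero]
  · rw [mul_add, add_mul, add_mul, hzx, hyw, hzw]; abel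
  · rw [mul_add, add_mul, add_mul, hxy, hwy, hxz]; abel
  · rw [mul_add, hfy, ← hkz, ← mul_assoc, hfk]
  · rw [add_mul, hxf, ← hwk, mul_assoc, hkf]

end Ring

/-! ### Unital and stable are incompatible -/

namespace MInfty

variable {S : Type*} [NonUnitalRing S]

/-- The matrix with upper left `n × n` corner given by `F` and zeros elsewhere. -/
def ofCorner (n : ℕ) (F : ℕ → ℕ → S) : MInfty S :=
  ⟨Matrix.of fun i j => if i < n ∧ j < n then F i j else 0,
    n, fun i j h => if_neg (by omega)⟩

theorem entry_ofCorner (n : ℕ) (F : ℕ → ℕ → S) (i j : ℕ) :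
    (ofCorner n F).entry i j = if i < n ∧ j < n then F i j else 0 := rfl

theorem not_isUnitalRing [Nontrivial S] : ¬ IsUnitalRing (MInfty S) := by
  rintro ⟨E, hE⟩
  obtain ⟨n, hn⟩ := E.exists_bound
  obtain ⟨s, hs⟩ := exists_ne (0 : S)
  -- Row `n` of `E` is zero, while the test matrix has `s` at `(n, n)`.
  have h := congrArg (fun A => entry A n n) (hE (ofCorner (n + 1) fun _ _ => s)).1
  simp only [entry_mul_range _ _ hn, entry_ofCorner] at h
  rw [if_pos (by omega), Finset.sum_eq_zero fun j _ => by rw [hn n j (Or.inl le_rfl), zero_mul]]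
    at h
  exact hs h.symm

end MInfty

theorem not_isUnitalRing_and_isStableRing {R : Type*} [NonUnitalRing R] [Nontrivial R] :
    ¬ (IsUnitalRing R ∧ IsStableRing R) := by
  rintro ⟨⟨e, he⟩, S, _, ⟨φ⟩⟩
  have : Nontrivial S := by
    by_contra h
    rw [not_nontrivial_iff_subsingleton] at h
    obtain ⟨a, ha⟩ := exists_ne (0 : R)
    refine ha (φ.injective (MInfty.ext fun i j => Subsingleton.elim _ _))
  refine MInfty.not_isUnitalRing (S := S) ⟨φ e, fun A => ?_⟩
  obtain ⟨a, rfl⟩ := φ.surjective A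
  rw [← map_mul, ← map_mul, (he a).1, (he a).2]
  exact ⟨rfl, rfl⟩

/-! ### Stability from a sequence of idempotents -/

/-- The corner ring `f R f` of an idempotent `f`. -/
def cornerSubring {R : Type*} [NonUnitalRing R] (f : R) : NonUnitalSubring R where
  carrier := {r | f * r = r ∧ r * f = r}
  zero_mem' := ⟨mul_zero f, zero_mul f⟩
  add_mem' := fun ha hb => ⟨by rw [mul_add, ha.1, hb.1], by rw [add_mul, ha.2, hb.2]⟩
  neg_mem' := fun ha => ⟨by rw [mul_neg, ha.1], by rw [neg_mul, ha.2]⟩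
  mul_mem' := fun ha hb => ⟨by rw [← mul_assoc, ha.1], by rw [mul_assoc, hb.2]⟩

section Stable

variable {R : Type*} [NonUnitalRing R]

/-- If the differences of an increasing sequence of idempotents, which is an approximate unit,
are all equivalent to `f`, then the ring is stable. -/
theorem isStableRing_of_seq {f : R} {e x y : ℕ → R} (he0 : e 0 = 0)
    (he : ∀ n, IsIdempotentElem (e n)) (hse : ∀ n, e (n + 1) * e n = e n)
    (hes : ∀ n, e n * e (n + 1) = e n)
    (hxy : ∀ n, x n * y n = f) (hyx : ∀ n, y n * x n = e (n + 1) - e n)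
    (hfx : ∀ n, f * x n = x n) (hyf : ∀ n, y n * f = y n)
    (hunit : ∀ r : R, ∃ n, e n * r = r ∧ r * e n = r) : IsStableRing R := by
  have hle : ∀ {m n}, m ≤ n → e n * e m = e m ∧ e m * e n = e m := by
    intro m n hmn
    induction n, hmn using Nat.le_induction with
    | base => exact ⟨he m, he m⟩
    | succ n hmn ih =>
      constructor
      · rw [← ih.1, ← mul_assoc, hse]
      · rw [← ih.2, mul_assoc, hes]
  have hx1 : ∀ n, x n * e (n + 1) = x n ∧ x n * e n = 0 := by
    intro n
    have h : x n * (e (n + 1) - e n) = x n := by rw [← hyx, ← mul_assoc, hxy, hfx]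
    constructor <;> rw [← h, mul_assoc, sub_mul]
    · rw [(he (n + 1)).eq, hes]
    · rw [hse, (he n).eq, sub_self, mul_zero]
  have hy1 : ∀ n, e (n + 1) * y n = y n ∧ e n * y n = 0 := by
    intro n
    have h : (e (n + 1) - e n) * y n = y n := by rw [← hyx, mul_assoc, hxy, hyf]
    constructor <;> rw [← h, ← mul_assoc, mul_sub]
    · rw [(he (n + 1)).eq, hse]
    · rw [hes, (he n).eq, sub_self, zero_mul]
  have hxe : ∀ {n i}, n ≤ i → x i * e n = 0 := fun {n i} h => by
    rw [← (hle h).1, ← mul_assoc, (hx1 i).2, zero_mul]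
  have hey : ∀ {n i}, n ≤ i → e n * y i = 0 := fun {n i} h => by
    rw [← (hle h).2, mul_assoc, (hy1 i).2, mul_zero]
  have hxyne : ∀ {i j}, i ≠ j → x i * y j = 0 := by
    intro i j hij
    rcases lt_or_gt_of_ne hij with h | h
    · rw [← (hx1 i).1, mul_assoc, hey h, mul_zero]
    · rw [← (hy1 j).1, ← mul_assoc, hxe h, zero_mul]
  have hsum : ∀ n, ∑ i ∈ Finset.range n, y i * x i = e n := fun n => by
    simp only [hyx, Finset.sum_range_sub, he0, sub_zero]
  have hmem : ∀ i r j, x i * r * y j ∈ cornerSubring f := fun i r j =>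
    ⟨by rw [← mul_assoc, ← mul_assoc, hfx], by rw [mul_assoc, hyf]⟩
  have hbd : ∀ {n r}, e n * r = r → r * e n = r → ∀ {i j : ℕ}, n ≤ i ∨ n ≤ j →
      x i * r * y j = 0 := by
    intro n r h1 h2 i j h
    rcases h with h | h
    · rw [← h1, ← mul_assoc, hxe h, zero_mul, zero_mul]
    · rw [← h2, mul_assoc, mul_assoc, hey h, mul_zero, mul_zero]
  -- The increments `y i * x i` are orthogonal, each identified with `f` by `x i` and `y i`; thus `x
  -- i * r * y j` is the `(i, j)` block of `r`, transported to the corner.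
  let F : R → MInfty (cornerSubring f) := fun r =>
    ⟨Matrix.of fun i j => ⟨x i * r * y j, hmem i r j⟩, by
      obtain ⟨n, h1, h2⟩ := hunit r
      exact ⟨n, fun i j h => Subtype.ext (hbd h1 h2 h)⟩⟩
  have hF : ∀ r i j, ((F r).entry i j : R) = x i * r * y j := fun _ _ _ => rfl
  have hrec : ∀ {n r}, e n * r = r → r * e n = r →
      ∑ i ∈ Finset.range n, ∑ j ∈ Finset.range n, y i * (x i * r * y j) * x j = r := by
    intro n r h1 h2
    calc _ = (∑ i ∈ Finset.range n, y i * x i) * r * ∑ j ∈ Finset.range n, y j * x j := by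
          simp only [Finset.sum_mul, Finset.mul_sum, mul_assoc]
          exact Finset.sum_comm
      _ = r := by rw [hsum, h1, h2]
  let φ : R →ₙ+* MInfty (cornerSubring f) :=
    { toFun := F
      map_zero' := by
        ext i j
        rw [hF, mul_zero, zero_mul]; rfl
      map_add' := fun r s => by
        ext i j
        rw [MInfty.entry_add, AddMemClass.coe_add, hF, hF, hF, mul_add, add_mul]
      map_mul' := fun r s => by
        obtain ⟨n, h1, h2⟩ := hunit r
        ext i k
        have hFn : ∀ i j, n ≤ i ∨ n ≤ j → (F r).entry i j = 0 := fun i j h =>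
          Subtype.ext (hbd h1 h2 h)
        rw [MInfty.entry_mul_range (F r) (F s) hFn, hF, AddSubmonoidClass.coe_finsetSum]
        simp only [MulMemClass.coe_mul, hF]
        calc x i * (r * s) * y k
            = x i * r * (∑ j ∈ Finset.range n, y j * x j) * s * y k := by
              rw [hsum, mul_assoc (x i) r (e n), h2, mul_assoc (x i) r s]
          _ = _ := by simp only [Finset.sum_mul, Finset.mul_sum, mul_assoc] }
  refine ⟨cornerSubring f, inferInstance, ⟨RingEquiv.ofBijective φ ⟨?_, ?_⟩⟩⟩
  · rw [injective_iff_map_eq_zero]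
    intro r hr
    obtain ⟨n, h1, h2⟩ := hunit r
    rw [← hrec h1 h2]
    refine Finset.sum_eq_zero fun i _ => Finset.sum_eq_zero fun j _ => ?_
    have h : x i * r * y j = 0 :=
      congrArg (fun A => ((MInfty.entry A i j : cornerSubring f) : R)) hr
    rw [h, mul_zero, zero_mul]
  · intro A
    obtain ⟨n, hn⟩ := A.exists_bound
    refine ⟨∑ i ∈ Finset.range n, ∑ j ∈ Finset.range n, y i * (A.entry i j : R) * x j, ?_⟩
    ext k l
    have hkl : ∀ i j, x k * (y i * (A.entry i j : R) * x j) * y l =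
        if k = i then (if l = j then (A.entry k l : R) else 0) else 0 := by
      intro i j
      have : x k * (y i * (A.entry i j : R) * x j) * y l =
        x k * y i * (A.entry i j : R) * (x j * y l) := by simp only [mul_assoc]
      rw [this]
      split_ifs with h1 h2
      · subst h1 h2
        rw [hxy, hxy, (A.entry k l).2.1, (A.entry k l).2.2]
      · rw [hxyne (Ne.symm h2), mul_zero]
      · rw [hxyne h1, zero_mul, zero_mul]
    change x k * _ * y l = _
    simp only [Finset.mul_sum, Finset.sum_mul, hkl]
    by_cases hk : k < n
    · by_cases hl : l < n
      · simp [hk, hl]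
      · simp [hn k l (Or.inr (not_lt.1 hl))]
    · simp [hn k l (Or.inl (not_lt.1 hk))]

theorem IsPurelyInfiniteSimple.isStableRing (hσ : IsSigmaUnital R)
    (hR : IsPurelyInfiniteSimple R) (hu : ¬ IsUnitalRing R) : IsStableRing R := by
  obtain ⟨u, hu'⟩ := hσ.exists_seq
  have hloc : ∀ a b : R, ∃ u : R, u * a = a ∧ a * u = a ∧ u * b = b ∧ b * u = b := fun a b =>
    (hu' a b).imp' u fun _ h => h
  have horth := exists_orthogonal_isFullIdempotent hloc hR hu
  -- Only fullness matters here; orthogonality to `0` is void.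
  obtain ⟨f, hf, -⟩ := horth 0
  choose g hg hge heg hga hag hgf using fun (e : {e : R // IsIdempotentElem e}) (a : R) =>
    exists_isIdempotentElem_extension hloc horth hf e.2 a
  let e : ℕ → {e : R // IsIdempotentElem e} := fun n =>
    Nat.rec ⟨0, IsIdempotentElem.zero⟩ (fun n d => ⟨g d (u n), hg d (u n)⟩) n
  choose x y hxy hyx hfx hyf using fun n => hgf (e n) (u n)
  have hyx' : ∀ n, y n * x n = (e (n + 1)).1 - (e n).1 := hyx
  refine isStableRing_of_seq (e := fun n => (e n).1) (x := x) (y := y) rfl (fun n => (e n).2)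
    (fun n => hge (e n) (u n)) (fun n => heg (e n) (u n)) hxy hyx' hfx hyf fun r => ?_
  obtain ⟨n, h1, h2, -⟩ := hu' r r
  -- `e (n + 1)` was built to absorb `u n`, hence everything `u n` fixes.
  refine ⟨n + 1, ?_, ?_⟩
  · have h : (e (n + 1) : R) * u n = u n := hga (e n) (u n)
    rw [← h1, ← mul_assoc, h]
  · have h : u n * (e (n + 1) : R) = u n := hag (e n) (u n)
    rw [← h2, mul_assoc, h]

end Stable

theorem corollary2p6 {R : Type*} [NonUnitalRing R] (hσ : IsSigmaUnital R)
    (hR : IsPurelyInfiniteSimple R) :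
    (IsUnitalRing R ∨ IsStableRing R) ∧ ¬ (IsUnitalRing R ∧ IsStableRing R) := by
  have : IsSimpleRing R := hR.1
  exact ⟨or_iff_not_imp_left.2 (hR.isStableRing hσ), not_isUnitalRing_and_isStableRing⟩
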